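/- Let $p$ be a prime, let $\mathbb C_p$ be the completion of an algebraic closure of $\mathbb Q_p$ with $|p|_p=p^{-1}$, and let $d\ge 1$ be an integer. Let $u\in\mathbb C_p$ satisfy $|1-u^f|_p\ge 1$ for every positive integer $f$, let $q\in\mathbb C_p$ satisfy $q\neq 1$ and $|1-q|_p<p^{-1/(p-1)}$, let $a_1\in\mathbb Z_p^{\times}$, and let $\chi$ be a Dirichlet character modulo $d$ with values in $\mathbb C_p$. **Notation.** Put $X=\varprojlim_N \mathbb Z/dp^N\mathbb Z$, with its canonical projection $X\to\mathbb Z_p$, through which $x\in X$ is regarded as a $p$-adic integer where needed, and $X^*=\bigcup_{0<a<dp,\,(a,p)=1}(a+dp\mathbb Z_p)$, where $a+dp^N\mathbb Z_p=\{x\in X: x\equiv a \bmod dp^N\}$. For $x \in\mathbb Z_p$ write $q^x=\exp(x\log_p q)$ and $[x:q]=\frac{1-q^x}{1-q}$; for a natural number $m$ write $[m:z]=\frac{1-z^m}{1-z}$. Let $\omega$ be the Teichmüller character (mod $p$ if $p$ is odd, mod $4$ if $p=2$), i.e. for $x\in\mathbb Z_p^\times$, $\omega(x)\in\mathbb Z_p$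 is the root of unity of order dividing $p-1$ (resp. $2$ if $p=2$) with $\omega(x)\equiv x$ mod $p$ (resp. mod $4$). For $x\in\mathbb Z_p^\times$ put $\langle x:q\rangle=[x:q]/\omega(x)$, and put $y^s=\exp(s\log_p y)$ for $s\in\mathbb Z_p$, $|y-1|_p<p^{-1/(p-1)}$. For $f:X\to\mathbb C_p$ put $$\int_X f\,d\mu_u=\lim_{N\to\infty}\frac1{[dp^N:u]}\sum_{x=0}^{dp^N-1}f(x)u^x,$$ and let an integral over $X^*$ be the integral over $X$ of the integrand extended by $0$. For $\psi:X^*\to\mathbb C_p$, $s\in\mathbb Z_p$ and an integer $k\ge 0$ define $$L_{p,q:a_1}(u|s,\psi)=\int_{X^*}\langle a_1x:q\rangle^{-s}\psi(x)\,d\mu_u(x),\qquad H^{(1)}_{k,\chi}(u,q|a_1)=\int_X\chi(x)[a_1x:q]^k\,d\mu_u(x).$$ **Claim.** 1. For every $x\in X^*$, $|\langle a_1x:q\rangle-1|_p<p^{-1/(p-1)}$. For all $s\in\mathbb Z_p$ and all integers $k\ge0$, the limits that define $L_{p,q:a_1}(u|s,\chi\omega^k)$, $H^{(1)}_{k,\chi}(u,q|a_1)$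 and $H^{(1)}_{k,\chi}(u^p,q^p|a_1)$ exist. 2. For every integer $k\ge0$, $$\frac1{1-u}L_{p,q:a_1}(u|-k,\chi\omega^k)=\omega(a_1)^{-k}\left(\frac1{1-u}H^{(1)}_{k,\chi}(u,q|a_1)-\frac{\chi(p)[p:q]^k}{1-u^p}H^{(1)}_{k,\chi}(u^p,q^p|a_1)\right).$$ 3. (Kummer congruence.) For all integers $n,k,k'\ge0$ with $k\equiv k' \pmod{(p-1)p^n}$, $$L_{p,q:a_1}(u|-k,\chi\omega^k)\equiv L_{p,q:a_1}(u|-k',\chi\omega^{k'})\pmod{p^n},$$ that is, the difference has absolute value at most $p^{-n}$. -/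

import Mathlib

open Filter Topology
open scoped PadicComplex

noncomputable section

namespace QEuler

/-- The ring `X = lim_N ℤ / d p^N ℤ`, as compatible sequences. -/
def X (p d : ℕ) : Subring ((N : ℕ) → ZMod (d * p ^ N)) where
  carrier := {x | ∀ N, ZMod.castHom (mul_dvd_mul_left d (pow_dvd_pow p N.le_succ))
    (ZMod (d * p ^ N)) (x (N + 1)) = x N}
  mul_mem' hx hy N := by simp only [Pi.mul_apply, map_mul, hx N, hy N]
  one_mem' N := by simp only [Pi.one_apply, map_one]
  add_mem' hx hy N := by simp only [Pi.add_apply, map_add, hx N, hy N]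
  zero_mem' N := by simp only [Pi.zero_apply, map_zero]
  neg_mem' hx N := by simp only [Pi.neg_apply, map_neg, hx N]

/-- The reduction `X → ℤ / d p^N ℤ`. -/
def X.level (p d N : ℕ) : X p d →+* ZMod (d * p ^ N) :=
  (Pi.evalRingHom _ N).comp (X p d).subtype

/-- The reduction `X → ℤ / d ℤ`. -/
def X.modD (p d : ℕ) : X p d →+* ZMod d :=
  (ZMod.castHom (Dvd.intro _ rfl) (ZMod d)).comp (X.level p d 0)

/-- The reduction `X → ℤ / p^N ℤ`. -/
def X.modPPow (p d N : ℕ) : X p d →+* ZMod (p ^ N) :=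
  (ZMod.castHom (Dvd.intro_left _ rfl) (ZMod (p ^ N))).comp (X.level p d N)

theorem X.modPPow_succ (p d N : ℕ) :
    (ZMod.castHom (pow_dvd_pow p N.le_succ) (ZMod (p ^ N))).comp (X.modPPow p d (N + 1)) =
      X.modPPow p d N := by
  ext x
  have h : ZMod.castHom (mul_dvd_mul_left d (pow_dvd_pow p N.le_succ))
    (ZMod (d * p ^ N)) (X.level p d (N + 1) x) = X.level p d N x := x.2 N
  simp only [X.modPPow, RingHom.comp_apply]
  rw [← h]
  simp only [← RingHom.comp_apply]
  rw [← RingHom.comp_assoc, ← RingHom.comp_assoc]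
  congr 2
  exact Subsingleton.elim _ _

theorem X.modPPow_compat (p d : ℕ) (k1 k2 : ℕ) (hk : k1 ≤ k2) :
    (ZMod.castHom (pow_dvd_pow p hk) (ZMod (p ^ k1))).comp (X.modPPow p d k2) =
      X.modPPow p d k1 := by
  induction k2, hk using Nat.le_induction with
  | base =>
    rw [Subsingleton.elim (ZMod.castHom (pow_dvd_pow p le_rfl) (ZMod (p ^ k1))) (RingHom.id _)]
    exact RingHom.id_comp _
  | succ k hk ih =>
    rw [← ih, ← X.modPPow_succ p d k, ← RingHom.comp_assoc]
    congr 1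
    exact Subsingleton.elim _ _

/-- The canonical projection `X → ℤ_p`. -/
def X.toZp (p d : ℕ) [Fact p.Prime] : X p d →+* ℤ_[p] :=
  PadicInt.lift (X.modPPow_compat p d)

/-- `X^*`, the union of the sets `a + dp ℤ_p` over `0 < a < dp` with `(a, p) = 1`. -/
def XStar (p d : ℕ) : Set (X p d) :=
  {x | ∃ a : ℕ, 0 < a ∧ a < d * p ∧ a.Coprime p ∧ X.level p d 1 x = (a : ZMod (d * p ^ 1))}

variable {p : ℕ} [Fact p.Prime]

/-- The embedding of `ℤ_p` in `ℂ_p`. -/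
def zpToCp : ℤ_[p] →+* ℂ_[p] :=
  (algebraMap ℚ_[p] ℂ_[p]).comp PadicInt.Coe.ringHom

/-- The `p`-adic logarithm `log_p y = ∑_{m ≥ 1} (-1)^(m+1) (y - 1)^m / m`, for `|y - 1| < 1`. -/
def logP (y : ℂ_[p]) : ℂ_[p] :=
  ∑' m : ℕ, (-1) ^ m * (y - 1) ^ (m + 1) / ((m : ℂ_[p]) + 1)

/-- `y ^ s = exp (s log_p y)` for `s ∈ ℤ_p` and `|y - 1| < p ^ (-1 / (p - 1))`. -/
def powP (y : ℂ_[p]) (s : ℤ_[p]) : ℂ_[p] :=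
  NormedSpace.exp (zpToCp s * logP y)

/-- `[m : z] = (1 - z ^ m) / (1 - z)` for a natural number `m`. -/
def qNat (m : ℕ) (z : ℂ_[p]) : ℂ_[p] := (1 - z ^ m) / (1 - z)

/-- `[x : q] = (1 - q ^ x) / (1 - q)` for a `p`-adic integer `x`. -/
def qNum (x : ℤ_[p]) (q : ℂ_[p]) : ℂ_[p] := (1 - powP q x) / (1 - q)

/-- The modulus of the Teichmüller character: `4` if `p = 2`, and `p` otherwise. -/
def teichMod (p : ℕ) : ℕ := if p = 2 then 4 else p

open Classical in
/-- The Teichmüller character: for a unit `x` of `ℤ_p`, the unique `ζ ∈ ℤ_p` with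
`ζ ^ φ(e) = 1` and `ζ ≡ x (mod e)`, where `e = p` for odd `p` and `e = 4` for `p = 2`; it is
`0` if `x` is not a unit. -/
def teich (x : ℤ_[p]) : ℤ_[p] :=
  if h : ∃ ζ : ℤ_[p], ζ ^ (teichMod p).totient = 1 ∧ (teichMod p : ℤ_[p]) ∣ x - ζ
  then h.choose else 0

/-- `⟨x : q⟩ = [x : q] / ω(x)`. -/
def angle (x : ℤ_[p]) (q : ℂ_[p]) : ℂ_[p] := qNum x q / zpToCp (teich x)

variable {d : ℕ}

/-- The value `μ_u (a + d p^N ℤ_p) = u ^ a / [d p^N : u]`, for `0 ≤ a < d p^N`. -/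
def mu (d : ℕ) (u : ℂ_[p]) (N a : ℕ) : ℂ_[p] := u ^ a / qNat (d * p ^ N) u

/-- The `N`-th Riemann sum of `f : X → ℂ_p` with respect to `μ_u`. -/
def riemannSum (u : ℂ_[p]) (f : X p d → ℂ_[p]) (N : ℕ) : ℂ_[p] :=
  ∑ a ∈ Finset.range (d * p ^ N), f (a : X p d) * mu d u N a

/-- The Riemann sums of `f` with respect to `μ_u` converge. -/
def IntegrableMu (u : ℂ_[p]) (f : X p d → ℂ_[p]) : Prop :=
  ∃ I : ℂ_[p], Tendsto (riemannSum u f) atTop (𝓝 I)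

/-- The integral `∫_X f dμ_u`. -/
def integralMu (u : ℂ_[p]) (f : X p d → ℂ_[p]) : ℂ_[p] :=
  limUnder atTop (riemannSum u f)

/-- The function `x ↦ χ(x) ω(x) ^ k` on `X`; on `X^*` it is the Dirichlet character `χ ω^k`. -/
def twist (χ : DirichletCharacter ℂ_[p] d) (k : ℕ) (x : X p d) : ℂ_[p] :=
  χ (X.modD p d x) * zpToCp (teich (X.toZp p d x)) ^ k

/-- The function `x ↦ [a x : q] ^ k χ(x)` on `X`. -/
def eulerIntegrand (q : ℂ_[p]) (a : ℤ_[p]) (k : ℕ) (χ : DirichletCharacter ℂ_[p] d) (x : X p d) :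
    ℂ_[p] :=
  qNum (a * X.toZp p d x) q ^ k * χ (X.modD p d x)

/-- The generalized `q`-Euler-Barnes number
`H_{k,χ}^{(1)} (u, q | a) = ∫_X χ(x) [a x : q] ^ k dμ_u(x)`. -/
def eulerH (u q : ℂ_[p]) (a : ℤ_[p]) (k : ℕ) (χ : DirichletCharacter ℂ_[p] d) : ℂ_[p] :=
  integralMu u (eulerIntegrand q a k χ)

/-- The function on `X` equal to `⟨a x : q⟩ ^ (-s) ψ(x)` on `X^*` and to `0` elsewhere. -/
def lIntegrand (q : ℂ_[p]) (a s : ℤ_[p]) (ψ : X p d → ℂ_[p]) : X p d → ℂ_[p] :=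
  (XStar p d).indicator fun x => powP (angle (a * X.toZp p d x) q) (-s) * ψ x

/-- `L_{p,q:a} (u | s, ψ) = ∫_{X^*} ⟨a x : q⟩ ^ (-s) ψ(x) dμ_u(x)`. -/
def lFun (u q : ℂ_[p]) (a s : ℤ_[p]) (ψ : X p d → ℂ_[p]) : ℂ_[p] :=
  integralMu u (lIntegrand q a s ψ)

end QEuler

end

/-! Since |1 - u^f| ≥ 1 for all f ≥ 1, the masses u^a / [d p^N : u] have norm at most 1, and they
are additive under refinement of residue classes: μ_u is a bounded measure (`norm_mu_le_one`,
`sum_mu_succ`). By the ultrametric inequality, a function varying by at most p^(-N) on classes mod d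
p^N has convergent Riemann sums, and a uniform bound on the difference of two integrands passes to
their integrals.

The integrands have this regularity because x ↦ [x : q] is 1-Lipschitz, and |[x : q] - x| ≤ |q - 1|
puts ⟨ax : q⟩ in the open disc of radius p^(-1/(p-1)) about 1. On that disc exp inverts log, so y^s
interpolates ordinary powers (`exp_logP`, `powP_natCast`), and |y^(p^n) - 1| = p^(-n) |y - 1|
(`norm_pow_prime_pow_sub_one`).

The formula of part 2 already holds for finite Riemann sums: the indices outside X^* are the
multiples pb, where [pax : q] = [p : q] [ax : q^p] and the mass for u at level N + 1 is (1 - u)/(1 -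
u^p) times the mass of b for u^p at level N. The Kummer congruence is pointwise: for n ≥ 1 the
additional power of ω is 1, and the additional power of ⟨ax : q⟩ is within p^(-n) of 1. -/

namespace QEuler

/-! ### The p-adic exponential and logarithm. -/

section Analytic

variable {p : ℕ} [Fact p.Prime]

/-- The radius of convergence `p ^ (-1 / (p - 1))` of the `p`-adic exponential. -/
noncomputable def expRadius (p : ℕ) : ℝ := (p : ℝ) ^ (-(1 / ((p : ℝ) - 1)))

theorem one_lt_prime_cast : (1 : ℝ) < p := by exact_mod_cast (Fact.out : p.Prime).one_lt

theorem expRadius_pos : 0 < expRadius p :=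
  Real.rpow_pos_of_pos (zero_lt_one.trans one_lt_prime_cast) _

theorem expRadius_lt_one : expRadius p < 1 := by
  have := one_lt_prime_cast (p := p)
  apply Real.rpow_lt_one_of_one_lt_of_neg this
  have : 0 < 1 / ((p : ℝ) - 1) := by apply one_div_pos.2; linarith
  linarith

theorem expRadius_pow : expRadius p ^ (p - 1) = (p : ℝ)⁻¹ := by
  have h := one_lt_prime_cast (p := p)
  rw [expRadius, ← Real.rpow_natCast, ← Real.rpow_mul (by linarith),
    Nat.cast_sub (Fact.out : p.Prime).one_lt.le, Nat.cast_one, ← Real.rpow_neg_one]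
  congr 1
  have : (p : ℝ) - 1 ≠ 0 := by linarith
  field_simp

theorem norm_zpToCp (x : ℤ_[p]) : ‖zpToCp x‖ = ‖x‖ := by
  change ‖algebraMap ℚ_[p] ℂ_[p] (x : ℚ_[p])‖ = _
  rw [norm_algebraMap', PadicInt.norm_def]

theorem continuous_zpToCp : Continuous (zpToCp (p := p)) :=
  AddMonoidHomClass.continuous_of_bound zpToCp 1 fun x => by rw [norm_zpToCp, one_mul]

theorem norm_natCast (n : ℕ) : ‖(n : ℂ_[p])‖ = ‖(n : ℤ_[p])‖ := by
  rw [← norm_zpToCp, map_natCast]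

theorem norm_natCast_le_one (n : ℕ) : ‖(n : ℂ_[p])‖ ≤ 1 := by
  rw [norm_natCast]; exact PadicInt.norm_le_one _

theorem norm_prime : ‖(p : ℂ_[p])‖ = (p : ℝ)⁻¹ := by
  rw [norm_natCast, PadicInt.norm_p]

/-- Legendre's formula gives (p - 1) v_p((n+1)!) < n + 1, hence ≤ n. The exponent n in place of n +
1 is what leaves a full factor |z| in the bound for z^(n+1)/(n+1)!. -/
theorem expRadius_pow_le_norm_factorial (n : ℕ) :
    expRadius p ^ n ≤ ‖(((n + 1).factorial : ℕ) : ℂ_[p])‖ := by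
  have h0 : (((n + 1).factorial : ℕ) : ℚ_[p]) ≠ 0 := by exact_mod_cast (n + 1).factorial_ne_zero
  have h : (p - 1) * padicValNat p (n + 1).factorial ≤ n := by
    have := sub_one_mul_padicValNat_factorial_lt_of_ne_zero p (n := n + 1) n.succ_ne_zero
    omega
  rw [norm_natCast, PadicInt.norm_def, PadicInt.coe_natCast,
    Padic.norm_eq_zpow_neg_valuation h0, Padic.valuation_natCast, zpow_neg, zpow_natCast,
    ← inv_pow, ← expRadius_pow, ← pow_mul]
  exact pow_le_pow_of_le_one expRadius_pos.le expRadius_lt_one.le h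

theorem norm_pow_div_factorial_le (z : ℂ_[p]) (n : ℕ) :
    ‖z ^ (n + 1) / (((n + 1).factorial : ℕ) : ℂ_[p])‖ ≤ ‖z‖ * (‖z‖ / expRadius p) ^ n := by
  have hr : 0 < expRadius p ^ n := pow_pos expRadius_pos n
  rw [norm_div, norm_pow, div_pow, pow_succ', mul_div_assoc]
  gcongr
  exact expRadius_pow_le_norm_factorial n

theorem expRadius_le_radius :
    ENNReal.ofReal (expRadius p) ≤ (NormedSpace.expSeries ℂ_[p] ℂ_[p]).radius := by
  refine FormalMultilinearSeries.le_radius_of_bound _ 1 fun n => ?_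
  rw [Real.coe_toNNReal _ expRadius_pos.le]
  have h1 : ‖NormedSpace.expSeries ℂ_[p] ℂ_[p] n‖ ≤ ‖((n.factorial : ℕ) : ℂ_[p])‖⁻¹ := by
    rw [NormedSpace.expSeries, norm_smul, norm_inv]
    simp
  rcases n with _ | n
  · simpa using h1
  · calc _ ≤ (expRadius p ^ n)⁻¹ * expRadius p ^ (n + 1) := by
          refine mul_le_mul_of_nonneg_right (h1.trans ?_) (pow_pos expRadius_pos _).le
          exact inv_anti₀ (pow_pos expRadius_pos n) (expRadius_pow_le_norm_factorial n)
      _ = expRadius p := by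
          rw [pow_succ, ← mul_assoc, inv_mul_cancel₀ (pow_pos expRadius_pos n).ne', one_mul]
      _ ≤ 1 := expRadius_lt_one.le

theorem radius_pos : 0 < (NormedSpace.expSeries ℂ_[p] ℂ_[p]).radius :=
  (ENNReal.ofReal_pos.2 expRadius_pos).trans_le expRadius_le_radius

theorem mem_eball_of_norm_lt {z : ℂ_[p]} (hz : ‖z‖ < expRadius p) :
    z ∈ Metric.eball (0 : ℂ_[p]) (NormedSpace.expSeries ℂ_[p] ℂ_[p]).radius := by
  rw [Metric.mem_eball, edist_zero_right]
  refine lt_of_lt_of_le ?_ expRadius_le_radius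
  rw [← ofReal_norm]
  exact (ENNReal.ofReal_lt_ofReal_iff expRadius_pos).2 hz

theorem exp_add {x y : ℂ_[p]} (hx : ‖x‖ < expRadius p) (hy : ‖y‖ < expRadius p) :
    NormedSpace.exp (x + y) = NormedSpace.exp x * NormedSpace.exp y :=
  NormedSpace.exp_add_of_mem_ball (𝕂 := ℂ_[p]) (mem_eball_of_norm_lt hx) (mem_eball_of_norm_lt hy)

theorem norm_exp_sub_one_le {z : ℂ_[p]} (hz : ‖z‖ < expRadius p) :
    ‖NormedSpace.exp z - 1‖ ≤ ‖z‖ := by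
  have h := NormedSpace.expSeries_div_hasSum_exp_of_mem_ball (𝕂 := ℂ_[p]) z (mem_eball_of_norm_lt hz)
  have h' := (hasSum_nat_add_iff' 1).2 h
  simp only [Finset.range_one, Finset.sum_singleton, pow_zero, Nat.factorial_zero, Nat.cast_one,
    div_one] at h'
  rw [← h'.tsum_eq]
  refine IsUltrametricDist.norm_tsum_le_of_forall_le_of_nonneg (norm_nonneg _) fun n => ?_
  refine (norm_pow_div_factorial_le z n).trans (mul_le_of_le_one_right (norm_nonneg _) ?_)
  exact pow_le_one₀ (by have := expRadius_pos (p := p); positivity)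
    ((div_le_one expRadius_pos).2 hz.le)

theorem norm_eq_one_of_norm_sub_one_lt {w : ℂ_[p]} (h : ‖w - 1‖ < 1) : ‖w‖ = 1 := by
  have : ‖w - 1 + 1‖ = max ‖w - 1‖ ‖(1 : ℂ_[p])‖ :=
    IsUltrametricDist.norm_add_eq_max_of_norm_ne_norm (by rw [norm_one]; exact h.ne)
  rw [sub_add_cancel, norm_one, max_eq_right h.le] at this
  exact this

theorem norm_exp_eq_one {z : ℂ_[p]} (hz : ‖z‖ < expRadius p) : ‖NormedSpace.exp z‖ = 1 :=
  norm_eq_one_of_norm_sub_one_lt (((norm_exp_sub_one_le hz).trans_lt hz).trans expRadius_lt_one)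

theorem norm_sub_le_max' (x y : ℂ_[p]) : ‖x - y‖ ≤ max ‖x‖ ‖y‖ :=
  by
  rw [sub_eq_add_neg, ← norm_neg y]
  exact IsUltrametricDist.norm_add_le_max x (-y)

theorem norm_exp_sub_exp_le {x y : ℂ_[p]} (hx : ‖x‖ < expRadius p) (hy : ‖y‖ < expRadius p) :
    ‖NormedSpace.exp x - NormedSpace.exp y‖ ≤ ‖x - y‖ := by
  have hxy : ‖x - y‖ < expRadius p := (norm_sub_le_max' x y).trans_lt (max_lt hx hy)
  have : NormedSpace.exp x - NormedSpace.exp y =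
      NormedSpace.exp y * (NormedSpace.exp (x - y) - 1) := by
    rw [mul_sub, ← exp_add hy hxy, mul_one, add_sub_cancel]
  rw [this, norm_mul, norm_exp_eq_one hy, one_mul]
  exact norm_exp_sub_one_le hxy

theorem norm_natCast_mul_lt {z : ℂ_[p]} {r : ℝ} (hz : ‖z‖ < r) (n : ℕ) : ‖(n : ℂ_[p]) * z‖ < r := by
  rw [norm_mul]
  exact (mul_le_of_le_one_left (norm_nonneg _) (norm_natCast_le_one n)).trans_lt hz

theorem exp_natCast_mul {z : ℂ_[p]} (hz : ‖z‖ < expRadius p) (n : ℕ) :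
    NormedSpace.exp ((n : ℂ_[p]) * z) = NormedSpace.exp z ^ n := by
  induction n with
  | zero => simp
  | succ n ih =>
    rw [Nat.cast_succ, add_mul, one_mul, exp_add (norm_natCast_mul_lt hz n) hz, ih, pow_succ]

/-- With w = 1 + t, the linear term pt of the binomial expansion strictly dominates: |t|^(p-1) < 1/p
handles t^p, and every other term is divisible by p t^2. -/
theorem norm_pow_prime_sub_one {w : ℂ_[p]} (hw : ‖w - 1‖ < expRadius p) :
    ‖w ^ p - 1‖ = ‖w - 1‖ * (p : ℝ)⁻¹ := by
  have hp : p.Prime := Fact.out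
  obtain ⟨t, rfl⟩ : ∃ t, w = t + 1 := ⟨w - 1, by ring⟩
  rw [add_sub_cancel_right] at hw ⊢
  rcases eq_or_ne t 0 with rfl | ht
  · simp
  have ht' : 0 < ‖t‖ := norm_pos_iff.2 ht
  have ht1 : ‖t‖ < 1 := hw.trans expRadius_lt_one
  have hp0 : (0 : ℝ) < p := zero_lt_one.trans one_lt_prime_cast
  have key := add_pow_prime_eq hp t 1
  have h1 : (1 : ℕ) ∈ Finset.Ioo 0 p := Finset.mem_Ioo.2 ⟨one_pos, hp.one_lt⟩
  rw [← Finset.add_sum_erase _ _ h1] at key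
  set S := ∑ k ∈ (Finset.Ioo 0 p).erase 1, t ^ (k - 1) * 1 ^ (p - k - 1) * ((p.choose k / p : ℕ) : ℂ_[p])
    with hS
  have hSn : ‖S‖ ≤ ‖t‖ := by
    refine IsUltrametricDist.norm_sum_le_of_forall_le_of_nonneg (norm_nonneg _) fun k hk => ?_
    rw [Finset.mem_erase, Finset.mem_Ioo] at hk
    rw [one_pow, mul_one, norm_mul, norm_pow]
    refine (mul_le_of_le_one_right (by positivity) (norm_natCast_le_one _)).trans ?_
    exact pow_le_of_le_one ht'.le ht1.le (by omega)
  have e : (t + 1) ^ p - 1 = (p : ℂ_[p]) * t + (t ^ p + p * (t * S)) := by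
    rw [key]
    simp only [one_pow, mul_one, Nat.sub_self, pow_zero, Nat.choose_one_right, Nat.div_self hp.pos, Nat.cast_one]
    ring
  have h2 : ‖t ^ p + p * (t * S)‖ < ‖(p : ℂ_[p]) * t‖ := by
    refine (IsUltrametricDist.norm_add_le_max _ _).trans_lt (max_lt ?_ ?_)
    · rw [norm_pow, norm_mul, norm_prime, ← expRadius_pow,
        ← pow_sub_one_mul hp.ne_zero]
      exact mul_lt_mul_of_pos_right
        (pow_lt_pow_left₀ hw ht'.le (Nat.sub_pos_of_lt hp.one_lt).ne') ht'
    · rw [norm_mul, norm_mul, norm_mul, norm_prime]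
      refine mul_lt_mul_of_pos_left ?_ (inv_pos.2 hp0)
      exact mul_lt_of_lt_one_right ht' (hSn.trans_lt ht1)
  rw [e, IsUltrametricDist.norm_add_eq_max_of_norm_ne_norm h2.ne', max_eq_left h2.le, norm_mul,
    norm_prime, mul_comm]

theorem norm_pow_prime_pow_sub_one {w : ℂ_[p]} (hw : ‖w - 1‖ < expRadius p) (n : ℕ) :
    ‖w ^ p ^ n - 1‖ = ‖w - 1‖ * ((p : ℝ) ^ n)⁻¹ := by
  have hp1 : 1 < (p : ℝ) := one_lt_prime_cast
  induction n with
  | zero => simp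
  | succ n ih =>
    have h : ‖w ^ p ^ n - 1‖ < expRadius p := by
      rw [ih]
      refine (mul_le_of_le_one_right (norm_nonneg _) ?_).trans_lt hw
      exact inv_le_one_of_one_le₀ (one_le_pow₀ hp1.le)
    rw [pow_succ, pow_mul, norm_pow_prime_sub_one h, ih, mul_assoc, ← mul_inv, ← pow_succ]

theorem tendsto_prime_pow : Tendsto (fun n : ℕ => (p : ℂ_[p]) ^ n) atTop (𝓝 0) :=
  tendsto_pow_atTop_nhds_zero_of_norm_lt_one (by
    rw [norm_prime]; exact inv_lt_one_of_one_lt₀ one_lt_prime_cast)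

theorem prime_pow_ne_zero (n : ℕ) : (p : ℂ_[p]) ^ n ≠ 0 :=
  pow_ne_zero _ (Nat.cast_ne_zero.2 (Fact.out : p.Prime).ne_zero)

theorem choose_prime_pow_eq (n m : ℕ) :
    (((p ^ n).choose (m + 1) : ℕ) : ℂ_[p]) =
      p ^ n * ((p ^ n - 1).choose m : ℕ) / ((m : ℂ_[p]) + 1) := by
  have hm : (m : ℂ_[p]) + 1 ≠ 0 := by exact_mod_cast m.succ_ne_zero
  have hp : 1 ≤ p ^ n := Nat.one_le_pow _ _ (Fact.out : p.Prime).pos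
  rw [eq_div_iff hm]
  have := Nat.add_one_mul_choose_eq (p ^ n - 1) m
  rw [Nat.sub_add_cancel hp] at this
  exact_mod_cast this.symm

/-- The limit is the binomial coefficient of -1 over m. Induction uses Pascal's rule, since the
coefficient of p^n over m + 1 tends to 0. -/
theorem tendsto_choose_prime_pow_sub_one (m : ℕ) :
    Tendsto (fun n : ℕ => (((p ^ n - 1).choose m : ℕ) : ℂ_[p])) atTop (𝓝 ((-1) ^ m)) := by
  induction m with
  | zero => simp
  | succ m ih =>
    have h := ((tendsto_prime_pow (p := p)).mul ih).div_const ((m : ℂ_[p]) + 1) |>.sub ih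
    rw [zero_mul, zero_div, zero_sub, ← neg_one_mul, ← pow_succ'] at h
    refine h.congr fun n => ?_
    rw [← choose_prime_pow_eq]
    have hp : 1 ≤ p ^ n := Nat.one_le_pow _ _ (Fact.out : p.Prime).pos
    have e := Nat.choose_succ_succ (p ^ n - 1) m
    rw [Nat.succ_eq_add_one, Nat.succ_eq_add_one, Nat.sub_add_cancel hp] at e
    rw [e]
    push_cast
    ring

theorem norm_natCast_inv_le (n : ℕ) : ‖(n : ℂ_[p])‖⁻¹ ≤ n := by
  rcases Nat.eq_zero_or_pos n with rfl | hn
  · simp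
  have h0 : (n : ℚ_[p]) ≠ 0 := by exact_mod_cast hn.ne'
  rw [norm_natCast, PadicInt.norm_def, PadicInt.coe_natCast,
    Padic.norm_eq_zpow_neg_valuation h0, Padic.valuation_natCast, zpow_neg, inv_inv, zpow_natCast]
  exact_mod_cast Nat.le_of_dvd hn pow_padicValNat_dvd

/-- The binomial expansion of the left side tends term by term to the logarithm series; |m + 1|⁻¹ ≤
m + 1 supplies a summable dominating sequence. -/
theorem tendsto_logP {y : ℂ_[p]} (hy : ‖y - 1‖ < 1) :
    Tendsto (fun n : ℕ => (y ^ p ^ n - 1) / p ^ n) atTop (𝓝 (logP y)) := by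
  set t := y - 1 with ht
  have hyt : y = t + 1 := by rw [ht]; ring
  have hsum : ∀ n : ℕ, (y ^ p ^ n - 1) / p ^ n =
      ∑' m : ℕ, (((p ^ n - 1).choose m : ℕ) : ℂ_[p]) * t ^ (m + 1) / ((m : ℂ_[p]) + 1) := by
    intro n
    rw [tsum_eq_sum (s := Finset.range (p ^ n)), hyt, add_pow, Finset.sum_range_succ']
    · simp only [one_pow, mul_one, pow_zero, Nat.choose_zero_right, Nat.cast_one,
        add_sub_cancel_right, Finset.sum_div]
      refine Finset.sum_congr rfl fun m _ => ?_
      rw [choose_prime_pow_eq]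
      have := prime_pow_ne_zero (p := p) n
      field_simp
    · intro m hm
      rw [Finset.mem_range, not_lt] at hm
      have := Nat.one_le_pow n p (Fact.out : p.Prime).pos
      rw [Nat.choose_eq_zero_of_lt (by omega)]
      simp
  simp only [hsum, logP]
  refine tendsto_tsum_of_dominated_convergence
    (bound := fun m : ℕ => ((m + 1 : ℕ) : ℝ) * ‖t‖ ^ (m + 1)) ?_ ?_ ?_
  · have h := summable_pow_mul_geometric_of_norm_lt_one 1 (r := ‖t‖) (by rwa [norm_norm])
    simpa only [pow_one] using (summable_nat_add_iff 1).2 h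
  · intro m
    exact ((tendsto_choose_prime_pow_sub_one m).mul_const _).div_const _
  · refine Eventually.of_forall fun n m => ?_
    rw [norm_div, norm_mul, norm_pow, div_eq_mul_inv, mul_comm, ← Nat.cast_succ]
    gcongr
    · exact norm_natCast_inv_le _
    · exact mul_le_of_le_one_left (by positivity) (norm_natCast_le_one _)

theorem norm_logP {y : ℂ_[p]} (hy : ‖y - 1‖ < expRadius p) : ‖logP y‖ = ‖y - 1‖ := by
  refine tendsto_nhds_unique (tendsto_logP (hy.trans expRadius_lt_one)).norm ?_
  refine tendsto_const_nhds.congr fun n => ?_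
  have : (p : ℝ) ≠ 0 := (zero_lt_one.trans one_lt_prime_cast).ne'
  rw [norm_div, norm_pow_prime_pow_sub_one hy, norm_pow, norm_prime, inv_pow]
  field_simp

/-- This is the derivative at t = 0 of t ↦ exp(tz), taken along t = p^n. -/
theorem tendsto_exp_sub_one_div (z : ℂ_[p]) :
    Tendsto (fun n : ℕ => (NormedSpace.exp ((p : ℂ_[p]) ^ n * z) - 1) / p ^ n) atTop (𝓝 z) := by
  have h1 : HasDerivAt (NormedSpace.exp : ℂ_[p] → ℂ_[p]) 1 (0 * z) := by
    rw [zero_mul]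
    exact hasDerivAt_exp_zero_of_radius_pos radius_pos
  have h2 : HasDerivAt (fun t : ℂ_[p] => NormedSpace.exp (t * z)) z 0 := by
    have h := h1.comp (0 : ℂ_[p]) ((hasDerivAt_id (0 : ℂ_[p])).mul_const z)
    rw [one_mul, one_mul] at h
    exact h
  have h3 := hasDerivAt_iff_tendsto_slope.1 h2
  have h4 : Tendsto (fun n : ℕ => (p : ℂ_[p]) ^ n) atTop (𝓝[≠] 0) :=
    tendsto_nhdsWithin_iff.2 ⟨tendsto_prime_pow, Eventually.of_forall fun n => prime_pow_ne_zero n⟩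
  refine (h3.comp h4).congr fun n => ?_
  simp [slope_def_field]

/-- Let E = exp(log y). Both (E^(p^n) - 1)/p^n and (y^(p^n) - 1)/p^n tend to log y, while their
difference has norm |E - y| for every n. No composition of power series is needed. -/
theorem exp_logP {y : ℂ_[p]} (hy : ‖y - 1‖ < expRadius p) : NormedSpace.exp (logP y) = y := by
  have hy1 : ‖y‖ = 1 := norm_eq_one_of_norm_sub_one_lt (hy.trans expRadius_lt_one)
  have hy0 : y ≠ 0 := norm_ne_zero_iff.1 (by rw [hy1]; exact one_ne_zero)
  have hl : ‖logP y‖ < expRadius p := by rwa [norm_logP hy]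
  set E := NormedSpace.exp (logP y) with hE
  have hEy : ‖E - y‖ < expRadius p := by
    rw [← sub_sub_sub_cancel_right E y 1]
    refine (norm_sub_le_max' _ _).trans_lt (max_lt ?_ hy)
    exact (norm_exp_sub_one_le hl).trans_lt hl
  have hw : ‖E / y - 1‖ = ‖E - y‖ := by
    rw [div_sub_one hy0, norm_div, hy1, div_one]
  have h := ((tendsto_exp_sub_one_div (logP y)).sub
    (tendsto_logP (hy.trans expRadius_lt_one))).norm
  rw [sub_self, norm_zero] at h
  have h' : ‖E - y‖ = 0 := by
    refine tendsto_nhds_unique ?_ h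
    refine tendsto_const_nhds.congr fun n => ?_
    have hp : (p : ℝ) ≠ 0 := (zero_lt_one.trans one_lt_prime_cast).ne'
    have e := norm_pow_prime_pow_sub_one (w := E / y) (by rwa [hw]) n
    rw [hw, div_pow, div_sub_one (pow_ne_zero _ hy0), norm_div, norm_pow, hy1, one_pow,
      div_one] at e
    rw [← sub_div, sub_sub_sub_cancel_right, norm_div, ← Nat.cast_pow,
      exp_natCast_mul hl, ← hE, e, Nat.cast_pow, norm_pow, norm_prime, inv_pow]
    field_simp
  exact sub_eq_zero.1 (norm_eq_zero.1 h')

/-! ### Powers with p-adic exponents and q-numbers. -/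

theorem norm_zpToCp_mul_logP_lt {y : ℂ_[p]} (hy : ‖y - 1‖ < expRadius p) (s : ℤ_[p]) :
    ‖zpToCp s * logP y‖ < expRadius p := by
  rw [norm_mul, norm_zpToCp, norm_logP hy]
  exact (mul_le_of_le_one_left (norm_nonneg _) (PadicInt.norm_le_one s)).trans_lt hy

theorem powP_natCast {y : ℂ_[p]} (hy : ‖y - 1‖ < expRadius p) (n : ℕ) :
    powP y (n : ℤ_[p]) = y ^ n := by
  rw [powP, map_natCast, exp_natCast_mul (by rwa [norm_logP hy]), exp_logP hy]

theorem norm_powP_sub_powP_le {y : ℂ_[p]} (hy : ‖y - 1‖ < expRadius p) (s t : ℤ_[p]) :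
    ‖powP y s - powP y t‖ ≤ ‖s - t‖ * ‖y - 1‖ := by
  refine (norm_exp_sub_exp_le (norm_zpToCp_mul_logP_lt hy s)
    (norm_zpToCp_mul_logP_lt hy t)).trans_eq ?_
  rw [← sub_mul, ← map_sub, norm_mul, norm_zpToCp, norm_logP hy]

theorem norm_powP {y : ℂ_[p]} (hy : ‖y - 1‖ < expRadius p) (s : ℤ_[p]) : ‖powP y s‖ = 1 :=
  norm_exp_eq_one (norm_zpToCp_mul_logP_lt hy s)

theorem continuous_powP {y : ℂ_[p]} (hy : ‖y - 1‖ < expRadius p) : Continuous (powP y) := by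
  refine LipschitzWith.continuous (K := 1) (LipschitzWith.of_dist_le_mul fun s t => ?_)
  rw [dist_eq_norm, dist_eq_norm, NNReal.coe_one, one_mul]
  exact (norm_powP_sub_powP_le hy s t).trans
    (mul_le_of_le_one_right (norm_nonneg _) (hy.trans expRadius_lt_one).le)

theorem norm_pow_sub_pow_le {x y : ℂ_[p]} (hx : ‖x‖ ≤ 1) (hy : ‖y‖ ≤ 1) (n : ℕ) :
    ‖x ^ n - y ^ n‖ ≤ ‖x - y‖ := by
  rw [← (Commute.all x y).geom_sum₂_mul, norm_mul]
  refine mul_le_of_le_one_left (norm_nonneg _) ?_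
  refine IsUltrametricDist.norm_sum_le_of_forall_le_of_nonneg zero_le_one fun i _ => ?_
  rw [norm_mul, norm_pow, norm_pow]
  exact mul_le_one₀ (pow_le_one₀ (norm_nonneg _) hx) (by positivity) (pow_le_one₀ (norm_nonneg _) hy)

/-- For natural exponents x^n - y^n is (x - y) times an integral factor; density of ℕ in ℤ_p gives
the rest. -/
theorem norm_powP_base_sub_le {x y : ℂ_[p]} (hx : ‖x - 1‖ < expRadius p)
    (hy : ‖y - 1‖ < expRadius p) (s : ℤ_[p]) : ‖powP x s - powP y s‖ ≤ ‖x - y‖ := by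
  refine PadicInt.denseRange_natCast.induction_on
    (p := fun s : ℤ_[p] => ‖powP x s - powP y s‖ ≤ ‖x - y‖) s ?_ fun n => ?_
  · exact isClosed_le ((continuous_powP hx).sub (continuous_powP hy)).norm continuous_const
  · rw [powP_natCast hx, powP_natCast hy]
    exact norm_pow_sub_pow_le (norm_eq_one_of_norm_sub_one_lt (hx.trans expRadius_lt_one)).le
      (norm_eq_one_of_norm_sub_one_lt (hy.trans expRadius_lt_one)).le n

theorem norm_pow_prime_sub_one_lt {q : ℂ_[p]} (hq : ‖q - 1‖ < expRadius p) :
    ‖q ^ p - 1‖ < expRadius p := by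
  rw [norm_pow_prime_sub_one hq]
  exact (mul_le_of_le_one_right (norm_nonneg _)
    (inv_le_one_of_one_le₀ one_lt_prime_cast.le)).trans_lt hq

theorem pow_prime_ne_one {q : ℂ_[p]} (hq : ‖q - 1‖ < expRadius p) (hq1 : q ≠ 1) : q ^ p ≠ 1 := by
  rw [← sub_ne_zero, ← norm_ne_zero_iff, norm_pow_prime_sub_one hq]
  exact mul_ne_zero (norm_ne_zero_iff.2 (sub_ne_zero.2 hq1))
    (inv_ne_zero (zero_lt_one.trans one_lt_prime_cast).ne')

theorem powP_prime_mul {q : ℂ_[p]} (hq : ‖q - 1‖ < expRadius p) (s : ℤ_[p]) :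
    powP q ((p : ℤ_[p]) * s) = powP (q ^ p) s := by
  have hq' := norm_pow_prime_sub_one_lt hq
  refine congr_fun (PadicInt.denseRange_natCast.equalizer
    ((continuous_powP hq).comp (continuous_const_mul (p : ℤ_[p]))) (continuous_powP hq') ?_) s
  ext n
  simp only [Function.comp_apply]
  rw [← Nat.cast_mul, powP_natCast hq, powP_natCast hq', pow_mul]

theorem qNum_prime_mul {q : ℂ_[p]} (hq : ‖q - 1‖ < expRadius p) (hq1 : q ≠ 1) (s : ℤ_[p]) :
    qNum ((p : ℤ_[p]) * s) q = qNat p q * qNum s (q ^ p) := by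
  have h : 1 - q ^ p ≠ 0 := sub_ne_zero.2 (pow_prime_ne_one hq hq1).symm
  rw [qNum, qNum, qNat, powP_prime_mul hq]
  have : 1 - q ≠ 0 := sub_ne_zero.2 hq1.symm
  field_simp

theorem norm_qNum_sub_qNum_le {q : ℂ_[p]} (hq : ‖q - 1‖ < expRadius p) (s t : ℤ_[p]) :
    ‖qNum s q - qNum t q‖ ≤ ‖s - t‖ := by
  rw [qNum, qNum, ← sub_div, sub_sub_sub_cancel_left, norm_div, norm_sub_rev s t]
  refine div_le_of_le_mul₀ (norm_nonneg _) (norm_nonneg _) ?_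
  rw [norm_sub_rev 1 q]
  exact norm_powP_sub_powP_le hq t s

/-- For natural n, [n : q] - n is the sum of q^i - 1 over i < n, each term divisible by q - 1; the
bound extends by density. -/
theorem norm_qNum_sub_le {q : ℂ_[p]} (hq : ‖q - 1‖ < expRadius p) (hq1 : q ≠ 1) (s : ℤ_[p]) :
    ‖qNum s q - zpToCp s‖ ≤ ‖q - 1‖ := by
  have hq0 : 1 - q ≠ 0 := sub_ne_zero.2 hq1.symm
  have hqn : ‖q‖ = 1 := norm_eq_one_of_norm_sub_one_lt (hq.trans expRadius_lt_one)
  refine PadicInt.denseRange_natCast.induction_on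
    (p := fun s : ℤ_[p] => ‖qNum s q - zpToCp s‖ ≤ ‖q - 1‖) s ?_ fun n => ?_
  · exact isClosed_le ((((continuous_const.sub (continuous_powP hq)).div_const _)).sub
      continuous_zpToCp).norm continuous_const
  · have e : qNum (n : ℤ_[p]) q - zpToCp (n : ℤ_[p]) = ∑ i ∈ Finset.range n, (q ^ i - 1) := by
      rw [qNum, powP_natCast hq, map_natCast, Finset.sum_sub_distrib, div_eq_of_eq_mul hq0
        (geom_sum_mul_neg q n).symm]
      simp
    rw [e]
    refine IsUltrametricDist.norm_sum_le_of_forall_le_of_nonneg (norm_nonneg _) fun i _ => ?_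
    simpa using norm_pow_sub_pow_le hqn.le norm_one.le i

theorem norm_qNum_le_one {q : ℂ_[p]} (hq : ‖q - 1‖ < expRadius p) (s : ℤ_[p]) :
    ‖qNum s q‖ ≤ 1 := by
  have h := norm_qNum_sub_qNum_le hq s 0
  rw [sub_zero, qNum, qNum, powP, powP, map_zero, zero_mul, NormedSpace.exp_zero, sub_self,
    zero_div, sub_zero] at h
  exact h.trans (PadicInt.norm_le_one s)

end Analytic

end QEuler

namespace QEuler

/-! ### The Teichmüller character. -/

section Teichmuller

variable {p : ℕ} [Fact p.Prime]

/-- The modulus 4 is forced at p = 2: there |2| equals the radius 1/2, and the strict inequality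
would fail. -/
theorem norm_teichMod_lt : ‖(teichMod p : ℤ_[p])‖ < expRadius p := by
  have hp : p.Prime := Fact.out
  rw [teichMod]
  split_ifs with h
  · subst h
    have h1 : expRadius 2 = (2 : ℝ)⁻¹ := by simpa using expRadius_pow (p := 2)
    have h2 : ‖((4 : ℕ) : ℤ_[2])‖ = (2 : ℝ)⁻¹ ^ 2 := by
      have := PadicInt.norm_p (p := 2)
      rw [show ((4 : ℕ) : ℤ_[2]) = ((2 : ℕ) : ℤ_[2]) ^ 2 by norm_num, norm_pow, this]
      norm_num
    rw [h1, h2]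
    norm_num
  · rw [PadicInt.norm_p, ← expRadius_pow]
    have h2 := hp.two_le
    exact pow_lt_self_of_lt_one₀ expRadius_pos expRadius_lt_one (by omega)

theorem totient_teichMod_dvd : (teichMod p).totient ∣ p * (p - 1) := by
  have hp : p.Prime := Fact.out
  rw [teichMod]
  split_ifs with h
  · subst h
    decide
  · rw [Nat.totient_prime hp]
    exact dvd_mul_left _ _

theorem totient_teichMod_pos : 0 < (teichMod p).totient := by
  have hp : p.Prime := Fact.out
  rw [Nat.totient_pos, teichMod]
  split_ifs
  · norm_num
  · exact hp.pos

theorem teichMod_dvd_sq : (teichMod p : ℤ_[p]) ∣ (p : ℤ_[p]) ^ 2 := by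
  rw [teichMod]
  split_ifs with h
  · subst h
    norm_num
  · exact dvd_pow_self _ two_ne_zero

theorem norm_lt_of_teichMod_dvd {x : ℤ_[p]} (h : (teichMod p : ℤ_[p]) ∣ x) :
    ‖x‖ < expRadius p := by
  obtain ⟨y, rfl⟩ := h
  rw [norm_mul]
  exact (mul_le_of_le_one_right (norm_nonneg _) (PadicInt.norm_le_one y)).trans_lt norm_teichMod_lt

/-- For odd p, Hensel's lemma applies to T^(p-1) - 1 at x, where the derivative is a unit. For p =
2, the units mod 4 are ±1. -/
theorem exists_teich {x : ℤ_[p]} (hx : IsUnit x) :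
    ∃ ζ : ℤ_[p], ζ ^ (teichMod p).totient = 1 ∧ (teichMod p : ℤ_[p]) ∣ x - ζ := by
  have hp : p.Prime := Fact.out
  rw [teichMod]
  split_ifs with h
  · subst h
    have hk : ∀ y : ℤ_[2], PadicInt.toZModPow 2 y = 0 → ((4 : ℕ) : ℤ_[2]) ∣ y := fun y hy => by
      rw [← RingHom.mem_ker, PadicInt.ker_toZModPow, Ideal.mem_span_singleton] at hy
      convert hy using 1
      norm_num
    have hu : ∀ z : ZMod (2 ^ 2), IsUnit z → z = 1 ∨ z = -1 := by decide
    rcases hu _ (hx.map (PadicInt.toZModPow 2)) with h1 | h1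
    · exact ⟨1, one_pow _, hk _ (by rw [map_sub, h1, map_one, sub_self])⟩
    · refine ⟨-1, ?_, hk _ (by rw [map_sub, h1, map_neg, map_one, sub_self])⟩
      rw [show Nat.totient 4 = 2 by decide]
      norm_num
  · have hxn : ‖x‖ = 1 := PadicInt.isUnit_iff.1 hx
    have hd : ‖Polynomial.aeval x (Polynomial.derivative
        (Polynomial.X ^ (p - 1) - 1 : Polynomial ℤ_[p]))‖ = 1 := by
      have h1 : ‖((p - 1 : ℕ) : ℤ_[p])‖ = 1 := by
        rw [PadicInt.norm_natCast_eq_one_iff, hp.coprime_iff_not_dvd]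
        exact Nat.not_dvd_of_pos_of_lt (Nat.sub_pos_of_lt hp.one_lt) (Nat.sub_lt hp.pos one_pos)
      simp only [Polynomial.derivative_sub, Polynomial.derivative_X_pow, Polynomial.derivative_one,
        sub_zero, map_mul, map_pow, Polynomial.aeval_X, Polynomial.aeval_C, norm_mul, norm_pow,
        hxn, one_pow, mul_one]
      simp [h1]
    have hlt : ‖Polynomial.aeval x (Polynomial.X ^ (p - 1) - 1 : Polynomial ℤ_[p])‖ <
        ‖Polynomial.aeval x (Polynomial.derivative
          (Polynomial.X ^ (p - 1) - 1 : Polynomial ℤ_[p]))‖ ^ 2 := by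
      rw [hd, one_pow, ← PadicInt.mem_nonunits, ← IsLocalRing.mem_maximalIdeal,
        ← PadicInt.ker_toZMod, RingHom.mem_ker]
      simp only [map_sub, map_pow, Polynomial.aeval_X, map_one]
      rw [ZMod.pow_card_sub_one_eq_one (hx.map PadicInt.toZMod).ne_zero, sub_self]
    obtain ⟨z, hz, hzx, -⟩ := hensels_lemma hlt
    refine ⟨z, ?_, ?_⟩
    · rw [Nat.totient_prime hp]
      simpa [sub_eq_zero] using hz
    · rwa [hd, norm_sub_rev, PadicInt.norm_lt_one_iff_dvd] at hzx

theorem norm_eq_one_of_pow_totient {ζ : ℤ_[p]} (h : ζ ^ (teichMod p).totient = 1) : ‖ζ‖ = 1 :=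
  PadicInt.isUnit_iff.1 (IsUnit.of_pow_eq_one h totient_teichMod_pos.ne')

/-- From p^2 = p(p - 1) + p one gets w^(p^2) = w^p, so |w - 1| p^(-2) = |w - 1| p^(-1). The exponent
p(p - 1) is a multiple of the order of ω for odd and even p alike. -/
theorem eq_one_of_pow_eq_one {w : ℂ_[p]} (hw : ‖w - 1‖ < expRadius p)
    (h : w ^ (p * (p - 1)) = 1) : w = 1 := by
  have hp : p.Prime := Fact.out
  have hp1 : (1 : ℝ) < p := one_lt_prime_cast
  have e : w ^ p ^ 2 = w ^ p ^ 1 := by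
    have : p ^ 2 = p * (p - 1) + p ^ 1 := by
      rw [pow_one, ← Nat.mul_succ, Nat.succ_eq_add_one, Nat.sub_add_cancel hp.one_lt.le, sq]
    rw [this, pow_add, h, one_mul]
  have h2 := norm_pow_prime_pow_sub_one hw 2
  rw [e, norm_pow_prime_pow_sub_one hw 1, pow_one, mul_eq_mul_left_iff, inv_inj] at h2
  rcases h2 with h2 | h2
  · nlinarith
  · exact sub_eq_zero.1 (norm_eq_zero.1 h2)

/-- The quotient ζ/ξ is a root of unity inside the disc about 1, hence trivial. This uniqueness
makes the chosen value `teich` multiplicative and locally constant on units. -/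
theorem eq_of_teichMod_dvd_sub {ζ ξ : ℤ_[p]} (hζ : ζ ^ (teichMod p).totient = 1)
    (hξ : ξ ^ (teichMod p).totient = 1) (h : (teichMod p : ℤ_[p]) ∣ ζ - ξ) : ζ = ξ := by
  have hn : ‖zpToCp ξ‖ = 1 := by rw [norm_zpToCp, norm_eq_one_of_pow_totient hξ]
  have h0 : zpToCp ξ ≠ 0 := norm_ne_zero_iff.1 (by rw [hn]; exact one_ne_zero)
  have hw : zpToCp ζ / zpToCp ξ = 1 := by
    apply eq_one_of_pow_eq_one
    · rw [div_sub_one h0, norm_div, hn, div_one, ← map_sub, norm_zpToCp]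
      exact norm_lt_of_teichMod_dvd h
    · obtain ⟨c, hc⟩ := totient_teichMod_dvd (p := p)
      rw [hc, pow_mul, div_pow, ← map_pow, ← map_pow, hζ, hξ, map_one, div_one, one_pow]
  have := (div_eq_one_iff_eq h0).1 hw
  rw [← sub_eq_zero, ← norm_eq_zero, ← norm_zpToCp, map_sub, this, sub_self, norm_zero]

theorem teich_spec {x : ℤ_[p]} (hx : IsUnit x) :
    teich x ^ (teichMod p).totient = 1 ∧ (teichMod p : ℤ_[p]) ∣ x - teich x := by
  have h := exists_teich hx
  rw [teich, dif_pos h]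
  exact h.choose_spec

theorem teich_eq {x ζ : ℤ_[p]} (hx : IsUnit x) (hζ : ζ ^ (teichMod p).totient = 1)
    (h : (teichMod p : ℤ_[p]) ∣ x - ζ) : teich x = ζ := by
  refine eq_of_teichMod_dvd_sub (teich_spec hx).1 hζ ?_
  simpa using dvd_sub h (teich_spec hx).2

theorem teich_mul {x y : ℤ_[p]} (hx : IsUnit x) (hy : IsUnit y) :
    teich (x * y) = teich x * teich y := by
  refine teich_eq (hx.mul hy) ?_ ?_
  · rw [mul_pow, (teich_spec hx).1, (teich_spec hy).1, one_mul]
  · have := dvd_add ((teich_spec hx).2.mul_right y) ((teich_spec hy).2.mul_left (teich x))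
    convert this using 1
    ring

theorem teich_congr {x y : ℤ_[p]} (hx : IsUnit x) (hy : IsUnit y)
    (h : (teichMod p : ℤ_[p]) ∣ x - y) : teich x = teich y := by
  refine teich_eq hx (teich_spec hy).1 ?_
  simpa using dvd_add h (teich_spec hy).2

theorem norm_teich {x : ℤ_[p]} (hx : IsUnit x) : ‖zpToCp (teich x)‖ = 1 := by
  rw [norm_zpToCp, norm_eq_one_of_pow_totient (teich_spec hx).1]

theorem teich_ne_zero {x : ℤ_[p]} (hx : IsUnit x) : zpToCp (teich x) ≠ 0 :=
  norm_ne_zero_iff.1 (by rw [norm_teich hx]; exact one_ne_zero)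

theorem teich_pow_eq_one {x : ℤ_[p]} (hx : IsUnit x) {m : ℕ} (hm : p * (p - 1) ∣ m) :
    zpToCp (teich x) ^ m = 1 := by
  obtain ⟨c, rfl⟩ := totient_teichMod_dvd.trans hm
  rw [pow_mul, ← map_pow, (teich_spec hx).1, map_one, one_pow]

theorem norm_angle_sub_one_lt {q : ℂ_[p]} (hq : ‖q - 1‖ < expRadius p) (hq1 : q ≠ 1)
    {x : ℤ_[p]} (hx : IsUnit x) : ‖angle x q - 1‖ < expRadius p := by
  rw [angle, div_sub_one (teich_ne_zero hx), norm_div, norm_teich hx, div_one,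
    ← sub_add_sub_cancel _ (zpToCp x) _]
  refine (IsUltrametricDist.norm_add_le_max _ _).trans_lt (max_lt ?_ ?_)
  · exact (norm_qNum_sub_le hq hq1 x).trans_lt hq
  · rw [← map_sub, norm_zpToCp]
    exact norm_lt_of_teichMod_dvd (teich_spec hx).2

end Teichmuller

/-! ### Congruences in X and the description of X^* as the preimage of the units. -/

section Space

variable {p d : ℕ}

theorem X.level_natCast (N a : ℕ) : X.level p d N (a : X p d) = (a : ZMod (d * p ^ N)) :=
  map_natCast _ a

theorem X.level_eq_of_le {x y : X p d} {M N : ℕ} (hMN : M ≤ N)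
    (h : X.level p d N x = X.level p d N y) : X.level p d M x = X.level p d M y := by
  induction N, hMN using Nat.le_induction with
  | base => exact h
  | succ N _ ih =>
    have hx : ZMod.castHom (mul_dvd_mul_left d (pow_dvd_pow p N.le_succ))
      (ZMod (d * p ^ N)) (X.level p d (N + 1) x) = X.level p d N x := x.2 N
    have hy : ZMod.castHom (mul_dvd_mul_left d (pow_dvd_pow p N.le_succ))
      (ZMod (d * p ^ N)) (X.level p d (N + 1) y) = X.level p d N y := y.2 N
    exact ih (by rw [← hx, ← hy, h])

theorem X.modD_eq_of_level_eq {x y : X p d} {N : ℕ}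
    (h : X.level p d N x = X.level p d N y) : X.modD p d x = X.modD p d y := by
  rw [X.modD, RingHom.comp_apply, RingHom.comp_apply, X.level_eq_of_le N.zero_le h]

end Space

section Space

variable {p : ℕ} [Fact p.Prime] {d : ℕ}

theorem X.prime_pow_dvd_of_level_eq {x y : X p d} {N : ℕ}
    (h : X.level p d N x = X.level p d N y) :
    (p : ℤ_[p]) ^ N ∣ X.toZp p d x - X.toZp p d y := by
  have key : ∀ z, PadicInt.toZModPow N (X.toZp p d z) = X.modPPow p d N z := fun z =>
    congrArg (fun φ : X p d →+* ZMod (p ^ N) => φ z)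
      (PadicInt.lift_spec (X.modPPow_compat p d) N)
  rw [← Ideal.mem_span_singleton, ← PadicInt.ker_toZModPow, RingHom.mem_ker, map_sub, key, key,
    X.modPPow, RingHom.comp_apply, RingHom.comp_apply, h, sub_self]

theorem X.norm_toZp_sub_le {x y : X p d} {N : ℕ}
    (h : X.level p d N x = X.level p d N y) :
    ‖X.toZp p d x - X.toZp p d y‖ ≤ ((p : ℝ) ^ N)⁻¹ := by
  have := (PadicInt.norm_le_pow_iff_mem_span_pow (X.toZp p d x - X.toZp p d y) N).2
    (Ideal.mem_span_singleton.2 (X.prime_pow_dvd_of_level_eq h))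
  rwa [zpow_neg, zpow_natCast] at this

theorem isUnit_iff_of_prime_dvd_sub {x y : ℤ_[p]} (h : (p : ℤ_[p]) ∣ x - y) :
    IsUnit x ↔ IsUnit y := by
  have key : ∀ z : ℤ_[p], IsUnit z ↔ ¬ (p : ℤ_[p]) ∣ z := fun z => by
    rw [← not_iff_not, not_not, PadicInt.not_isUnit_iff, PadicInt.norm_lt_one_iff_dvd]
  rw [key, key, not_iff_not]
  exact ⟨fun hx => (dvd_sub_right hx).1 h, fun hy => (dvd_sub_left hy).1 h⟩

theorem isUnit_natCast_iff {n : ℕ} : IsUnit (n : ℤ_[p]) ↔ ¬ p ∣ n := by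
  rw [PadicInt.isUnit_iff, PadicInt.norm_natCast_eq_one_iff,
    (Fact.out : p.Prime).coprime_iff_not_dvd]

theorem mem_XStar_iff (hd : 0 < d) {x : X p d} : x ∈ XStar p d ↔ IsUnit (X.toZp p d x) := by
  have hp : p.Prime := Fact.out
  have key : ∀ a : ℕ, X.level p d 1 x = (a : ZMod (d * p ^ 1)) →
      (IsUnit (X.toZp p d x) ↔ ¬ p ∣ a) := fun a ha => by
    rw [← X.level_natCast] at ha
    have h := X.prime_pow_dvd_of_level_eq ha
    rw [pow_one, map_natCast] at h
    rw [isUnit_iff_of_prime_dvd_sub h, isUnit_natCast_iff]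
  constructor
  · rintro ⟨a, -, -, hap, hx⟩
    rwa [key a hx, ← hp.coprime_iff_not_dvd, Nat.coprime_comm]
  · intro hx
    have : NeZero (d * p ^ 1) := ⟨(Nat.mul_pos hd (pow_pos hp.pos 1)).ne'⟩
    have ha : X.level p d 1 x = ((X.level p d 1 x).val : ZMod (d * p ^ 1)) :=
      (ZMod.natCast_zmod_val _).symm
    have h := (key _ ha).1 hx
    refine ⟨(X.level p d 1 x).val, ?_, ?_, ?_, ha⟩
    · exact Nat.pos_of_ne_zero fun h0 => h (h0 ▸ dvd_zero p)
    · simpa only [pow_one] using ZMod.val_lt (X.level p d 1 x)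
    · rwa [Nat.coprime_comm, hp.coprime_iff_not_dvd]

theorem mem_XStar_congr (hd : 0 < d) {x y : X p d} {N : ℕ} (hN : 1 ≤ N)
    (h : X.level p d N x = X.level p d N y) : x ∈ XStar p d ↔ y ∈ XStar p d := by
  rw [mem_XStar_iff hd, mem_XStar_iff hd]
  exact isUnit_iff_of_prime_dvd_sub ((dvd_pow_self _ (Nat.one_le_iff_ne_zero.1 hN)).trans
    (X.prime_pow_dvd_of_level_eq h))

theorem X.teichMod_dvd_of_level_eq {x y : X p d} {N : ℕ} (hN : 2 ≤ N)
    (h : X.level p d N x = X.level p d N y) :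
    (teichMod p : ℤ_[p]) ∣ X.toZp p d x - X.toZp p d y :=
  (teichMod_dvd_sq.trans (pow_dvd_pow _ hN)).trans (X.prime_pow_dvd_of_level_eq h)

end Space

end QEuler

namespace QEuler

/-! ### The measure μ_u and convergence of Riemann sums. -/

section Measure

variable {p : ℕ} [Fact p.Prime] {d : ℕ}

theorem one_sub_pow_ne_zero {u : ℂ_[p]} (hu : ∀ f : ℕ, 0 < f → 1 ≤ ‖1 - u ^ f‖) {m : ℕ}
    (hm : 0 < m) : 1 - u ^ m ≠ 0 :=
  norm_ne_zero_iff.1 (zero_lt_one.trans_le (hu m hm)).ne'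

theorem one_sub_ne_zero {u : ℂ_[p]} (hu : ∀ f : ℕ, 0 < f → 1 ≤ ‖1 - u ^ f‖) : 1 - u ≠ 0 := by
  simpa only [pow_one] using one_sub_pow_ne_zero hu one_pos

theorem norm_one_sub_le (x : ℂ_[p]) : ‖1 - x‖ ≤ max 1 ‖x‖ := by
  simpa only [norm_one] using norm_sub_le_max' 1 x

/-- Put M = d p^N. If |u| ≤ 1, the numerator u^a (1 - u) is integral and |1 - u^M| ≥ 1. If |u| > 1,
then |1 - u^M| = |u|^M, and a + 1 ≤ M suffices. -/
theorem norm_mu_le_one {u : ℂ_[p]} (hu : ∀ f : ℕ, 0 < f → 1 ≤ ‖1 - u ^ f‖) {N a : ℕ}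
    (ha : a < d * p ^ N) : ‖mu d u N a‖ ≤ 1 := by
  have hpos : 0 < d * p ^ N := a.zero_le.trans_lt ha
  have h := hu _ hpos
  rw [mu, qNat, div_div_eq_mul_div, norm_div, norm_mul, norm_pow]
  refine div_le_one_of_le₀ ?_ (norm_nonneg _)
  rcases le_or_gt ‖u‖ 1 with hu1 | hu1
  · refine le_trans (mul_le_one₀ (pow_le_one₀ (norm_nonneg _) hu1) (norm_nonneg _) ?_) h
    exact (norm_one_sub_le u).trans (max_le le_rfl hu1)
  · have h1 : 1 < ‖u ^ (d * p ^ N)‖ := by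
      rw [norm_pow]
      exact one_lt_pow₀ hu1 hpos.ne'
    have h2 : ‖1 - u ^ (d * p ^ N)‖ = ‖u‖ ^ (d * p ^ N) := by
      rw [sub_eq_add_neg, IsUltrametricDist.norm_add_eq_max_of_norm_ne_norm
        (by rw [norm_one, norm_neg]; exact h1.ne), norm_one, norm_neg, max_eq_right h1.le, norm_pow]
    rw [h2]
    calc ‖u‖ ^ a * ‖1 - u‖ ≤ ‖u‖ ^ a * ‖u‖ := by
          gcongr
          exact (norm_one_sub_le u).trans (max_le hu1.le le_rfl)
      _ = ‖u‖ ^ (a + 1) := (pow_succ _ _).symm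
      _ ≤ ‖u‖ ^ (d * p ^ N) := pow_le_pow_right₀ hu1.le ha

theorem sum_range_mul_eq {M : Type*} [AddCommMonoid M] (g : ℕ → M) (m n : ℕ) :
    ∑ x ∈ Finset.range (m * n), g x =
      ∑ j ∈ Finset.range n, ∑ a ∈ Finset.range m, g (m * j + a) := by
  induction n with
  | zero => simp
  | succ n ih => rw [Nat.mul_succ, Finset.sum_range_add, ih, Finset.sum_range_succ]

theorem sum_mu_succ (hd : 0 < d) {u : ℂ_[p]} (hu : ∀ f : ℕ, 0 < f → 1 ≤ ‖1 - u ^ f‖) (N a : ℕ) :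
    ∑ j ∈ Finset.range p, mu d u (N + 1) (d * p ^ N * j + a) = mu d u N a := by
  have hp : 0 < p := (Fact.out : p.Prime).pos
  have h1 := one_sub_pow_ne_zero hu (Nat.mul_pos hd (pow_pos hp N))
  have h2 := one_sub_pow_ne_zero hu (Nat.mul_pos hd (pow_pos hp (N + 1)))
  have h3 := one_sub_ne_zero hu
  have h4 := geom_sum_mul_neg (u ^ (d * p ^ N)) p
  simp only [mu, qNat, pow_add, pow_mul u (d * p ^ N), ← Finset.sum_div, ← Finset.sum_mul]
  rw [← pow_mul, mul_assoc, ← pow_succ] at h4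
  rw [eq_div_of_mul_eq h1 h4]
  rw [pow_one, ← pow_succ]
  field_simp

theorem riemannSum_eq_sum_succ (hd : 0 < d) {u : ℂ_[p]}
    (hu : ∀ f : ℕ, 0 < f → 1 ≤ ‖1 - u ^ f‖) (f : X p d → ℂ_[p]) (N : ℕ) :
    riemannSum u f N = ∑ j ∈ Finset.range p, ∑ a ∈ Finset.range (d * p ^ N),
      f (a : X p d) * mu d u (N + 1) (d * p ^ N * j + a) := by
  rw [Finset.sum_comm]
  refine Finset.sum_congr rfl fun a _ => ?_
  rw [← Finset.mul_sum, sum_mu_succ hd hu]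

theorem norm_riemannSum_sub_le {u : ℂ_[p]} (hu : ∀ f : ℕ, 0 < f → 1 ≤ ‖1 - u ^ f‖)
    {f g : X p d → ℂ_[p]} {C : ℝ} (hC : 0 ≤ C) (h : ∀ x, ‖f x - g x‖ ≤ C) (N : ℕ) :
    ‖riemannSum u f N - riemannSum u g N‖ ≤ C := by
  rw [riemannSum, riemannSum, ← Finset.sum_sub_distrib]
  refine IsUltrametricDist.norm_sum_le_of_forall_le_of_nonneg hC fun a ha => ?_
  rw [← sub_mul, norm_mul]
  exact (mul_le_of_le_one_right (norm_nonneg _) (norm_mu_le_one hu (Finset.mem_range.1 ha))).trans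
    (h _)

/-- Functions on `X` that vary by at most `p ^ (-N)` on the fibres of the reduction modulo
`d p ^ N`, for `N ≥ 2`. -/
def IsLevelLipschitz (f : X p d → ℂ_[p]) : Prop :=
  ∀ N, 2 ≤ N → ∀ x y, X.level p d N x = X.level p d N y → ‖f x - f y‖ ≤ ((p : ℝ) ^ N)⁻¹

theorem norm_riemannSum_succ_sub_le (hd : 0 < d) {u : ℂ_[p]}
    (hu : ∀ f : ℕ, 0 < f → 1 ≤ ‖1 - u ^ f‖) {f : X p d → ℂ_[p]} (hf : IsLevelLipschitz f)
    {N : ℕ} (hN : 2 ≤ N) : ‖riemannSum u f N - riemannSum u f (N + 1)‖ ≤ ((p : ℝ) ^ N)⁻¹ := by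
  have hC : 0 ≤ ((p : ℝ) ^ N)⁻¹ := by positivity
  rw [riemannSum_eq_sum_succ hd hu, riemannSum, pow_succ p N, ← mul_assoc, sum_range_mul_eq,
    ← Finset.sum_sub_distrib]
  refine IsUltrametricDist.norm_sum_le_of_forall_le_of_nonneg hC fun j hj => ?_
  rw [← Finset.sum_sub_distrib]
  refine IsUltrametricDist.norm_sum_le_of_forall_le_of_nonneg hC fun a ha => ?_
  rw [← sub_mul, norm_mul]
  rw [Finset.mem_range] at ha hj
  refine (mul_le_of_le_one_right (norm_nonneg _) (norm_mu_le_one hu ?_)).trans (hf N hN _ _ ?_)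
  · calc d * p ^ N * j + a < d * p ^ N * (j + 1) := by rw [Nat.mul_succ]; omega
      _ ≤ d * p ^ N * p := Nat.mul_le_mul_left _ hj
      _ = d * p ^ (N + 1) := by rw [pow_succ, mul_assoc]
  · rw [X.level_natCast, X.level_natCast, Nat.cast_add, Nat.cast_mul (d * p ^ N) j,
      ZMod.natCast_self, zero_mul, zero_add]

theorem IsLevelLipschitz.integrableMu (hd : 0 < d) {u : ℂ_[p]}
    (hu : ∀ f : ℕ, 0 < f → 1 ≤ ‖1 - u ^ f‖) {f : X p d → ℂ_[p]} (hf : IsLevelLipschitz f) :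
    IntegrableMu u f := by
  -- The Lipschitz control starts at level 2, hence the shift.
  have hc : CauchySeq fun n => riemannSum u f (n + 2) := by
    refine cauchySeq_of_le_geometric ((p : ℝ)⁻¹) ((p : ℝ) ^ 2)⁻¹
      (inv_lt_one_of_one_lt₀ one_lt_prime_cast) fun n => ?_
    rw [dist_eq_norm, inv_pow, ← mul_inv, ← pow_add, add_comm 2 n, add_right_comm]
    exact norm_riemannSum_succ_sub_le hd hu hf (Nat.le_add_left 2 n)
  obtain ⟨I, hI⟩ := cauchySeq_tendsto_of_complete hc
  exact ⟨I, (tendsto_add_atTop_iff_nat 2).1 hI⟩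

theorem IntegrableMu.tendsto {u : ℂ_[p]} {f : X p d → ℂ_[p]} (h : IntegrableMu u f) :
    Tendsto (riemannSum u f) atTop (𝓝 (integralMu u f)) :=
  tendsto_nhds_limUnder h

theorem norm_integralMu_sub_le {u : ℂ_[p]} (hu : ∀ f : ℕ, 0 < f → 1 ≤ ‖1 - u ^ f‖)
    {f g : X p d → ℂ_[p]} (hf : IntegrableMu u f) (hg : IntegrableMu u g) {C : ℝ} (hC : 0 ≤ C)
    (h : ∀ x, ‖f x - g x‖ ≤ C) : ‖integralMu u f - integralMu u g‖ ≤ C :=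
  le_of_tendsto (hf.tendsto.sub hg.tendsto).norm
    (Eventually.of_forall fun N => norm_riemannSum_sub_le hu hC h N)

theorem IsLevelLipschitz.mul {f g : X p d → ℂ_[p]} (hf : IsLevelLipschitz f)
    (hg : IsLevelLipschitz g) (hf1 : ∀ x, ‖f x‖ ≤ 1) (hg1 : ∀ x, ‖g x‖ ≤ 1) :
    IsLevelLipschitz fun x => f x * g x := by
  intro N hN x y h
  have e : f x * g x - f y * g y = f x * (g x - g y) + (f x - f y) * g y := by ring
  rw [e]
  refine (IsUltrametricDist.norm_add_le_max _ _).trans (max_le ?_ ?_)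
  · rw [norm_mul]
    exact (mul_le_of_le_one_left (norm_nonneg _) (hf1 x)).trans (hg N hN x y h)
  · rw [norm_mul]
    exact (mul_le_of_le_one_right (norm_nonneg _) (hg1 y)).trans (hf N hN x y h)

/-! ### Regularity of the integrands. -/

theorem isLevelLipschitz_character (χ : DirichletCharacter ℂ_[p] d) :
    IsLevelLipschitz fun x : X p d => χ (X.modD p d x) := by
  intro N _ x y h
  dsimp only
  rw [X.modD_eq_of_level_eq h, sub_self, norm_zero]
  positivity

theorem isLevelLipschitz_eulerIntegrand {q : ℂ_[p]} (hq : ‖q - 1‖ < expRadius p) (a : ℤ_[p])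
    (k : ℕ) (χ : DirichletCharacter ℂ_[p] d) : IsLevelLipschitz (eulerIntegrand q a k χ) := by
  refine IsLevelLipschitz.mul (f := fun x => qNum (a * X.toZp p d x) q ^ k) ?_
    (isLevelLipschitz_character χ) (fun x => ?_) fun x => χ.norm_le_one _
  · intro N _ x y h
    refine (norm_pow_sub_pow_le (norm_qNum_le_one hq _) (norm_qNum_le_one hq _) k).trans ?_
    refine (norm_qNum_sub_qNum_le hq _ _).trans ?_
    rw [← mul_sub, norm_mul]
    exact (mul_le_of_le_one_left (norm_nonneg _) (PadicInt.norm_le_one a)).trans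
      (X.norm_toZp_sub_le h)
  · rw [norm_pow]
    exact pow_le_one₀ (norm_nonneg _) (norm_qNum_le_one hq _)

theorem norm_twist_le_one (hd : 0 < d) (χ : DirichletCharacter ℂ_[p] d) (k : ℕ) {x : X p d}
    (hx : x ∈ XStar p d) : ‖twist χ k x‖ ≤ 1 := by
  rw [twist, norm_mul, norm_pow, norm_teich ((mem_XStar_iff hd).1 hx), one_pow, mul_one]
  exact χ.norm_le_one _

/-- From level 2 on, membership in X^*, χ and ω are constant on fibres (4 divides p^2 when p = 2),
so only [ax : q] varies. -/
theorem isLevelLipschitz_lIntegrand (hd : 0 < d) {q : ℂ_[p]} (hq : ‖q - 1‖ < expRadius p)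
    (hq1 : q ≠ 1) {a : ℤ_[p]} (ha : IsUnit a) (s : ℤ_[p]) (k : ℕ)
    (χ : DirichletCharacter ℂ_[p] d) : IsLevelLipschitz (lIntegrand q a s (twist χ k)) := by
  intro N hN x y h
  by_cases hx : x ∈ XStar p d
  · have hy : y ∈ XStar p d := (mem_XStar_congr hd (one_le_two.trans hN) h).1 hx
    have hxu := (mem_XStar_iff hd).1 hx
    have hyu := (mem_XStar_iff hd).1 hy
    have ht : teich (X.toZp p d x) = teich (X.toZp p d y) :=
      teich_congr hxu hyu (X.teichMod_dvd_of_level_eq hN h)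
    have hψ : twist χ k x = twist χ k y := by rw [twist, twist, X.modD_eq_of_level_eq h, ht]
    rw [lIntegrand, Set.indicator_of_mem hx, Set.indicator_of_mem hy, hψ, ← sub_mul, norm_mul]
    refine (mul_le_of_le_one_right (norm_nonneg _) (norm_twist_le_one hd χ k hy)).trans ?_
    refine (norm_powP_base_sub_le (norm_angle_sub_one_lt hq hq1 (ha.mul hxu))
      (norm_angle_sub_one_lt hq hq1 (ha.mul hyu)) _).trans ?_
    rw [angle, angle, teich_mul ha hxu, ht, ← teich_mul ha hyu, ← sub_div, norm_div,
      norm_teich (ha.mul hyu), div_one]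
    refine (norm_qNum_sub_qNum_le hq _ _).trans ?_
    rw [← mul_sub, norm_mul]
    exact (mul_le_of_le_one_left (norm_nonneg _) (PadicInt.norm_le_one a)).trans
      (X.norm_toZp_sub_le h)
  · have hy : y ∉ XStar p d := fun hy => hx ((mem_XStar_congr hd (one_le_two.trans hN) h).2 hy)
    rw [lIntegrand, Set.indicator_of_notMem hx, Set.indicator_of_notMem hy, sub_self, norm_zero]
    positivity

theorem one_le_norm_one_sub_pow_prime_pow {u : ℂ_[p]} (hu : ∀ f : ℕ, 0 < f → 1 ≤ ‖1 - u ^ f‖)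
    (f : ℕ) (hf : 0 < f) : 1 ≤ ‖1 - (u ^ p) ^ f‖ := by
  rw [← pow_mul]
  exact hu _ (Nat.mul_pos (Fact.out : p.Prime).pos hf)

/-! ### Values at negative integers and the Euler factor at p. -/

theorem lIntegrand_neg_natCast_of_mem (hd : 0 < d) {q : ℂ_[p]} (hq : ‖q - 1‖ < expRadius p)
    (hq1 : q ≠ 1) {a : ℤ_[p]} (ha : IsUnit a) (k l : ℕ) (χ : DirichletCharacter ℂ_[p] d)
    {x : X p d} (hx : x ∈ XStar p d) :
    lIntegrand q a (-(k : ℤ_[p])) (twist χ l) x =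
      angle (a * X.toZp p d x) q ^ k * twist χ l x := by
  rw [lIntegrand, Set.indicator_of_mem hx, neg_neg,
    powP_natCast (norm_angle_sub_one_lt hq hq1 (ha.mul ((mem_XStar_iff hd).1 hx)))]

theorem lIntegrand_neg_natCast (hd : 0 < d) {q : ℂ_[p]} (hq : ‖q - 1‖ < expRadius p)
    (hq1 : q ≠ 1) {a : ℤ_[p]} (ha : IsUnit a) (k : ℕ) (χ : DirichletCharacter ℂ_[p] d)
    (x : X p d) :
    lIntegrand q a (-(k : ℤ_[p])) (twist χ k) x =
      (zpToCp (teich a) ^ k)⁻¹ * (XStar p d).indicator (eulerIntegrand q a k χ) x := by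
  by_cases hx : x ∈ XStar p d
  · have hxu := (mem_XStar_iff hd).1 hx
    rw [lIntegrand_neg_natCast_of_mem hd hq hq1 ha k k χ hx, Set.indicator_of_mem hx, angle,
      teich_mul ha hxu, map_mul, twist, eulerIntegrand, div_pow, mul_pow]
    have h1 := teich_ne_zero ha
    have h2 := teich_ne_zero hxu
    field_simp
  · rw [lIntegrand, Set.indicator_of_notMem hx, Set.indicator_of_notMem hx, mul_zero]

theorem riemannSum_const_mul (u c : ℂ_[p]) (f : X p d → ℂ_[p]) (N : ℕ) :
    riemannSum u (fun x => c * f x) N = c * riemannSum u f N := by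
  simp only [riemannSum, Finset.mul_sum, mul_assoc]

theorem mu_succ_prime_mul (hd : 0 < d) {u : ℂ_[p]} (hu : ∀ f : ℕ, 0 < f → 1 ≤ ‖1 - u ^ f‖)
    (N b : ℕ) :
    mu d u (N + 1) (p * b) = (1 - u) / (1 - u ^ p) * mu d (u ^ p) N b := by
  have hp : 0 < p := (Fact.out : p.Prime).pos
  have h1 := one_sub_pow_ne_zero hu hp
  have h2 := one_sub_pow_ne_zero hu (Nat.mul_pos hd (pow_pos hp (N + 1)))
  have e : (u ^ p) ^ (d * p ^ N) = u ^ (d * p ^ (N + 1)) := by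
    rw [← pow_mul, pow_succ']
    congr 1
    ring
  rw [mu, mu, qNat, qNat, e, pow_mul]
  have h3 := one_sub_ne_zero hu
  field_simp

theorem eulerIntegrand_prime_mul {q : ℂ_[p]} (hq : ‖q - 1‖ < expRadius p) (hq1 : q ≠ 1)
    (a : ℤ_[p]) (k : ℕ) (χ : DirichletCharacter ℂ_[p] d) (x : X p d) :
    eulerIntegrand q a k χ ((p : X p d) * x) =
      χ (p : ZMod d) * qNat p q ^ k * eulerIntegrand (q ^ p) a k χ x := by
  rw [eulerIntegrand, eulerIntegrand, map_mul, map_mul, map_natCast, map_natCast, mul_left_comm,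
    qNum_prime_mul hq hq1, map_mul, mul_pow]
  ring

theorem natCast_mem_XStar_iff (hd : 0 < d) {n : ℕ} : (n : X p d) ∈ XStar p d ↔ ¬ p ∣ n := by
  rw [mem_XStar_iff hd, map_natCast, isUnit_natCast_iff]

/-- Writing an index as pb + j with j < p, the full sum and the sum over X^* differ only at j = 0,
where the substitution x = pb applies. -/
theorem riemannSum_indicator_XStar (hd : 0 < d) {u q : ℂ_[p]}
    (hu : ∀ f : ℕ, 0 < f → 1 ≤ ‖1 - u ^ f‖) (hq : ‖q - 1‖ < expRadius p) (hq1 : q ≠ 1)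
    (a : ℤ_[p]) (k : ℕ) (χ : DirichletCharacter ℂ_[p] d) (N : ℕ) :
    riemannSum u ((XStar p d).indicator (eulerIntegrand q a k χ)) (N + 1) =
      riemannSum u (eulerIntegrand q a k χ) (N + 1) -
        χ (p : ZMod d) * qNat p q ^ k * ((1 - u) / (1 - u ^ p)) *
          riemannSum (u ^ p) (eulerIntegrand (q ^ p) a k χ) N := by
  have hp : 0 < p := (Fact.out : p.Prime).pos
  rw [eq_sub_iff_add_eq, ← eq_sub_iff_add_eq']
  simp only [riemannSum]
  rw [← Finset.sum_sub_distrib, show d * p ^ (N + 1) = p * (d * p ^ N) by ring,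
    sum_range_mul_eq _ p (d * p ^ N), Finset.mul_sum]
  refine Finset.sum_congr rfl fun b _ => ?_
  rw [Finset.sum_eq_single_of_mem 0 (Finset.mem_range.2 hp)]
  · rw [add_zero, Set.indicator_of_notMem, zero_mul, sub_zero, mu_succ_prime_mul hd hu,
      Nat.cast_mul, eulerIntegrand_prime_mul hq hq1]
    · ring
    · rw [natCast_mem_XStar_iff hd, not_not]
      exact dvd_mul_right p b
  · intro j hj hj0
    rw [Set.indicator_of_mem, sub_self]
    rw [natCast_mem_XStar_iff hd, ← Nat.dvd_add_iff_right (dvd_mul_right p b)]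
    exact Nat.not_dvd_of_pos_of_lt (Nat.pos_of_ne_zero hj0) (Finset.mem_range.1 hj)

theorem lFun_neg_natCast (hd : 0 < d) {u q : ℂ_[p]} (hu : ∀ f : ℕ, 0 < f → 1 ≤ ‖1 - u ^ f‖)
    (hq : ‖q - 1‖ < expRadius p) (hq1 : q ≠ 1) {a : ℤ_[p]} (ha : IsUnit a) (k : ℕ)
    (χ : DirichletCharacter ℂ_[p] d) :
    lFun u q a (-(k : ℤ_[p])) (twist χ k) = (zpToCp (teich a) ^ k)⁻¹ *
      (eulerH u q a k χ - χ (p : ZMod d) * qNat p q ^ k * ((1 - u) / (1 - u ^ p)) *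
        eulerH (u ^ p) (q ^ p) a k χ) := by
  have hL := ((isLevelLipschitz_lIntegrand hd hq hq1 ha (-(k : ℤ_[p])) k χ).integrableMu
    hd hu).tendsto.comp (tendsto_add_atTop_nat 1)
  have hH := ((isLevelLipschitz_eulerIntegrand hq a k χ).integrableMu
    hd hu).tendsto.comp (tendsto_add_atTop_nat 1)
  have hH' := ((isLevelLipschitz_eulerIntegrand (norm_pow_prime_sub_one_lt hq) a k
    χ).integrableMu hd (one_le_norm_one_sub_pow_prime_pow hu)).tendsto
  -- Sums for u are taken at level N + 1 and sums for u^p at level N, matching the finite identity.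
  refine tendsto_nhds_unique hL ((hH.sub (hH'.const_mul (χ (p : ZMod d) * qNat p q ^ k *
    ((1 - u) / (1 - u ^ p))))).const_mul ((zpToCp (teich a) ^ k)⁻¹) |>.congr fun N => ?_)
  simp only [Function.comp_apply]
  rw [funext (lIntegrand_neg_natCast hd hq hq1 ha k χ), riemannSum_const_mul,
    riemannSum_indicator_XStar hd hu hq hq1]

/-! ### The Kummer congruence. -/

theorem norm_lIntegrand_le_one (hd : 0 < d) {q : ℂ_[p]} (hq : ‖q - 1‖ < expRadius p)
    (hq1 : q ≠ 1) {a : ℤ_[p]} (ha : IsUnit a) (s : ℤ_[p]) (k : ℕ)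
    (χ : DirichletCharacter ℂ_[p] d) (x : X p d) : ‖lIntegrand q a s (twist χ k) x‖ ≤ 1 := by
  by_cases hx : x ∈ XStar p d
  · rw [lIntegrand, Set.indicator_of_mem hx, norm_mul,
      norm_powP (norm_angle_sub_one_lt hq hq1 (ha.mul ((mem_XStar_iff hd).1 hx))), one_mul]
    exact norm_twist_le_one hd χ k hx
  · rw [lIntegrand, Set.indicator_of_notMem hx, norm_zero]
    exact zero_le_one

theorem norm_lIntegrand_sub_le (hd : 0 < d) {q : ℂ_[p]} (hq : ‖q - 1‖ < expRadius p)
    (hq1 : q ≠ 1) {a : ℤ_[p]} (ha : IsUnit a) (χ : DirichletCharacter ℂ_[p] d) (n k m : ℕ)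
    (x : X p d) :
    ‖lIntegrand q a (-(k : ℤ_[p])) (twist χ k) x -
      lIntegrand q a (-((k + (p - 1) * p ^ n * m : ℕ) : ℤ_[p]))
        (twist χ (k + (p - 1) * p ^ n * m)) x‖ ≤ ((p : ℝ) ^ n)⁻¹ := by
  -- For n = 0 integrality suffices. This case is separate because at p = 2 the exponent m need not
  -- annihilate ω.
  rcases Nat.eq_zero_or_pos n with rfl | hn
  · rw [pow_zero ((p : ℕ) : ℝ), inv_one]
    exact (norm_sub_le_max' _ _).trans (max_le (norm_lIntegrand_le_one hd hq hq1 ha _ _ χ x)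
      (norm_lIntegrand_le_one hd hq hq1 ha _ _ χ x))
  by_cases hx : x ∈ XStar p d
  · have hxu := (mem_XStar_iff hd).1 hx
    have hA := norm_angle_sub_one_lt hq hq1 (ha.mul hxu)
    have htw : twist χ (k + (p - 1) * p ^ n * m) x = twist χ k x := by
      rw [twist, twist, pow_add, teich_pow_eq_one hxu (m := (p - 1) * p ^ n * m), mul_one]
      -- Since n ≥ 1, the factor p^n supplies the p needed for divisibility by p(p - 1).
      rw [mul_comm p]
      exact (mul_dvd_mul_left _ (dvd_pow_self p hn.ne')).mul_right m
    rw [lIntegrand_neg_natCast_of_mem hd hq hq1 ha _ _ χ hx,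
      lIntegrand_neg_natCast_of_mem hd hq hq1 ha _ _ χ hx, htw, ← sub_mul, norm_mul]
    refine (mul_le_of_le_one_right (norm_nonneg _) (norm_twist_le_one hd χ k hx)).trans ?_
    have hA1 := norm_eq_one_of_norm_sub_one_lt (hA.trans expRadius_lt_one)
    rw [pow_add, ← mul_one_sub, norm_mul, norm_pow, hA1, one_pow, one_mul, norm_sub_rev,
      mul_comm (p - 1), mul_assoc, pow_mul]
    have h := norm_pow_sub_pow_le (x := angle (a * X.toZp p d x) q ^ p ^ n) (y := 1)
      (by rw [norm_pow, hA1, one_pow]) norm_one.le ((p - 1) * m)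
    rw [one_pow, norm_pow_prime_pow_sub_one hA] at h
    exact h.trans (mul_le_of_le_one_left (by positivity) (hA.trans expRadius_lt_one).le)
  · rw [lIntegrand, lIntegrand, Set.indicator_of_notMem hx, Set.indicator_of_notMem hx, sub_self,
      norm_zero]
    positivity

theorem norm_lFun_sub_le (hd : 0 < d) {u q : ℂ_[p]} (hu : ∀ f : ℕ, 0 < f → 1 ≤ ‖1 - u ^ f‖)
    (hq : ‖q - 1‖ < expRadius p) (hq1 : q ≠ 1) {a : ℤ_[p]} (ha : IsUnit a)
    (χ : DirichletCharacter ℂ_[p] d) {n k k' : ℕ} (hkk' : k ≤ k')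
    (h : k ≡ k' [MOD (p - 1) * p ^ n]) :
    ‖lFun u q a (-(k : ℤ_[p])) (twist χ k) - lFun u q a (-(k' : ℤ_[p])) (twist χ k')‖ ≤
      ((p : ℝ) ^ n)⁻¹ := by
  obtain ⟨m, hm⟩ := (Nat.modEq_iff_dvd' hkk').1 h
  obtain rfl : k' = k + (p - 1) * p ^ n * m := by omega
  exact norm_integralMu_sub_le hu
    ((isLevelLipschitz_lIntegrand hd hq hq1 ha _ _ χ).integrableMu hd hu)
    ((isLevelLipschitz_lIntegrand hd hq hq1 ha _ _ χ).integrableMu hd hu) (by positivity)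
    fun x => norm_lIntegrand_sub_le hd hq hq1 ha χ n k m x

end Measure

end QEuler

theorem mainTheorem7 (p : ℕ) [Fact p.Prime] (d : ℕ) (hd : 0 < d)
    (χ : DirichletCharacter ℂ_[p] d) (u q : ℂ_[p]) (a : ℤ_[p])
    (hu : ∀ f : ℕ, 0 < f → 1 ≤ ‖1 - u ^ f‖)
    (hq : ‖1 - q‖ < (p : ℝ) ^ (-(1 / ((p : ℝ) - 1)))) (hq1 : q ≠ 1)
    (ha : IsUnit a) :
    (∀ x ∈ QEuler.XStar p d,
      ‖QEuler.angle (a * QEuler.X.toZp p d x) q - 1‖ < (p : ℝ) ^ (-(1 / ((p : ℝ) - 1)))) ∧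
    (∀ (s : ℤ_[p]) (k : ℕ),
      QEuler.IntegrableMu u (QEuler.lIntegrand q a s (QEuler.twist χ k))) ∧
    (∀ k : ℕ,
      QEuler.IntegrableMu u (QEuler.eulerIntegrand q a k χ) ∧
      QEuler.IntegrableMu (u ^ p) (QEuler.eulerIntegrand (q ^ p) a k χ)) ∧
    (∀ k : ℕ,
      1 / (1 - u) * QEuler.lFun u q a (-(k : ℤ_[p])) (QEuler.twist χ k) =
        (QEuler.zpToCp (QEuler.teich a) ^ k)⁻¹ *
          (1 / (1 - u) * QEuler.eulerH u q a k χ -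
            χ (p : ZMod d) * QEuler.qNat p q ^ k / (1 - u ^ p) *
              QEuler.eulerH (u ^ p) (q ^ p) a k χ)) ∧
    (∀ n k k' : ℕ, k ≡ k' [MOD (p - 1) * p ^ n] →
      ‖QEuler.lFun u q a (-(k : ℤ_[p])) (QEuler.twist χ k) -
        QEuler.lFun u q a (-(k' : ℤ_[p])) (QEuler.twist χ k')‖ ≤ ((p : ℝ) ^ n)⁻¹) := by
  rw [norm_sub_rev] at hq
  refine ⟨fun x hx => QEuler.norm_angle_sub_one_lt hq hq1 (ha.mul ((QEuler.mem_XStar_iff hd).1 hx)),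
    fun s k => (QEuler.isLevelLipschitz_lIntegrand hd hq hq1 ha s k χ).integrableMu hd hu,
    fun k => ⟨(QEuler.isLevelLipschitz_eulerIntegrand hq a k χ).integrableMu hd hu,
      (QEuler.isLevelLipschitz_eulerIntegrand (QEuler.norm_pow_prime_sub_one_lt hq) a k
        χ).integrableMu hd (QEuler.one_le_norm_one_sub_pow_prime_pow hu)⟩,
    fun k => ?_, fun n k k' h => ?_⟩
  · have h1 := QEuler.one_sub_ne_zero hu
    have h2 := QEuler.one_sub_pow_ne_zero hu (Fact.out : p.Prime).pos
    rw [QEuler.lFun_neg_natCast hd hu hq hq1 ha k χ]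
    field_simp
  · rcases le_total k k' with hk | hk
    · exact QEuler.norm_lFun_sub_le hd hu hq hq1 ha χ hk h
    · rw [norm_sub_rev]
      exact QEuler.norm_lFun_sub_le hd hu hq hq1 ha χ hk h.symm
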